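/- A barotropic equation of state is a continuous function $\rho(p)$, $p\ge 0$, with $\rho(p)>0$ for $p>0$, such that $\eta(p)=\int_0^p \rho(p')^{-1}\,dp'$ exists for $p>0$. It is called asymptotically polytropic, with asymptotic indices $n_0$ (at low pressures) and $n_1$ (at high pressures), if $\eta$ runs through all of $(0,\infty)$, if $\rho$ is differentiable for $p>0$, and if the index-function $n(\eta)=\eta\,\frac{d\rho}{dp}=\frac{\eta}{\rho}\frac{d\rho}{d\eta}$ is non-negative, bounded and ${\mathcal C}^1$ on $(0,\infty)$ and satisfies $n(\eta)-n_0=O(\eta^{a_0})$ as $\eta\to 0$ and $n(\eta)-n_1=O(\eta^{-a_1})$ as $\eta\to\infty$ for some $a_0,a_1>0$. A regular perfect fluid solution of radius $R\in(0,\infty]$ is a solution $(m(r),p(r))$, $0<r<R$, of $$\frac{dm}{dr}=4\pi r^2\rho(p),\qquad \frac{dp}{dr}=-\frac{m\,\rho(p)}{r^2},$$ with $p>0$ on $(0,R)$, with $m(r)\to 0$ and $p(r)\to p_c\in(0,\infty)$ as $r\to 0$, and, if $R<\infty$, with $p(r)\to 0$ as $r\to R$. Theorem. For every real $n_0>3$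 there exists an asymptotically polytropic equation of state with asymptotic low-pressure index $n_0$ (and some high-pressure index $n_1$) for which some regular perfect fluid solution has infinite radius $R=\infty$, i.e. it exists with $p(r)>0$ for all $r>0$. -/

import Mathlib

open Set Filter Topology Asymptotics MeasureTheory

noncomputable section

/-- The quantity `η(p) = ∫₀ᵖ dp' / ρ(p')` of a barotropic equation of state `ρ = ρ(p)`. -/
def eta (ρ : ℝ → ℝ) (p : ℝ) : ℝ := ∫ s in (0 : ℝ)..p, (ρ s)⁻¹

/-- `ρ` is a barotropic equation of state: density as a continuous function of the pressure
`p ≥ 0`, positive for `p > 0`, and such that `η(p)` exists for `p > 0`. Only the values of `ρ` on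
`[0, ∞)` matter. -/
structure IsEquationOfState (ρ : ℝ → ℝ) : Prop where
  continuousOn : ContinuousOn ρ (Ici 0)
  pos : ∀ p, 0 < p → 0 < ρ p
  integrable : ∀ p, 0 < p → IntervalIntegrable (fun s => (ρ s)⁻¹) volume 0 p

/-- `n` is the index-function of `ρ`: for every `p > 0` the density is differentiable and
`n(η) = η dρ/dp = (η / ρ) dρ/dη` at `η = η(p)`. -/
def IsIndexFunction (ρ n : ℝ → ℝ) : Prop :=
  ∀ p, 0 < p → HasDerivAt ρ (n (eta ρ p) / eta ρ p) p

/-- The equation of state `ρ` is asymptotically polytropic with index `n₀` at low pressures and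
index `n₁` at high pressures. The condition `eta_tendsto` says that `η` runs through all of
`(0, ∞)`, so that the index-function is determined by `ρ` on `(0, ∞)`. -/
structure IsAsymptoticallyPolytropic (ρ : ℝ → ℝ) (n₀ n₁ : ℝ) : Prop where
  eos : IsEquationOfState ρ
  eta_tendsto : Tendsto (eta ρ) atTop atTop
  index : ∃ n : ℝ → ℝ, IsIndexFunction ρ n ∧
    ContDiffOn ℝ 1 n (Ioi 0) ∧
    (∀ x, 0 < x → 0 ≤ n x) ∧
    (∃ B : ℝ, ∀ x, 0 < x → |n x| ≤ B) ∧
    (∃ a₀ : ℝ, 0 < a₀ ∧ (fun x => n x - n₀) =O[𝓝[>] 0] (fun x => x ^ a₀)) ∧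
    (∃ a₁ : ℝ, 0 < a₁ ∧ (fun x => n x - n₁) =O[atTop] (fun x => x ^ (-a₁)))

/-- `(m, p)` is a regular static spherically symmetric perfect fluid solution (gravitational
constant `1`) with equation of state `ρ`, central pressure `pc` and radius `R ∈ (0, ∞]`: it solves
`dm/dr = 4πr²ρ`, `dp/dr = -mρ/r²` with `p > 0` for `0 < r < R`, at the centre the mass vanishes and
the pressure tends to `pc ∈ (0, ∞)`, and `p` vanishes at the surface `r = R` if `R < ∞`. -/
structure IsRegularSolution (ρ : ℝ → ℝ) (pc : ℝ) (R : EReal) (m p : ℝ → ℝ) : Prop where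
  radius_pos : 0 < R
  pc_pos : 0 < pc
  mass_center : Tendsto m (𝓝[>] 0) (𝓝 0)
  pressure_center : Tendsto p (𝓝[>] 0) (𝓝 pc)
  pressure_pos : ∀ r : ℝ, 0 < r → (r : EReal) < R → 0 < p r
  mass_eq : ∀ r : ℝ, 0 < r → (r : EReal) < R →
    HasDerivAt m (4 * Real.pi * r ^ 2 * ρ (p r)) r
  pressure_eq : ∀ r : ℝ, 0 < r → (r : EReal) < R →
    HasDerivAt p (-(m r * ρ (p r) / r ^ 2)) r
  surface : R ≠ ⊤ → Tendsto p (𝓝[<] R.toReal) (𝓝 0)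

end

/-! The star is chosen first and its equation of state is read off afterwards. In the inverse radius
`x = 1/r` the structure equations become `dm/dx = -4πρ/x⁴` and `dp/dx = mρ`, hence `dη/dx = m`.
Prescribe `ρ = 1` for `x ≥ 1` and a profile of order `xⁿ` near `x = 0`. Since `n > 3`, the total
mass `m(0)` is finite, so `η ~ m(0) x`, and the index `(η/m) d(log ρ)/dx` tends to `n` with a
power-law error (`exists_abs_indexParam_sub_le`). As `p > 0` for every `x > 0`, the radius is
infinite.

The star itself reaches only bounded `η` and `p`. Its core has constant density, however, so the
parametrisation there may be changed freely: replacing `m` by `stretchedMass` for `x > 1` makes both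
unbounded without altering `ρ(p)` along the star (`density_inverse_pressure`). Inverting the
resulting `p(x)` and `η(x)` gives the equation of state and its index-function, with high-pressure
index `0`. -/

/-! ### Calculus preliminaries -/

/-- A continuous function on `ℝ` that is increasing with positive derivative on `(0, ∞)`, vanishes
at `0` and is unbounded has an inverse on `[0, ∞)`, differentiable on `(0, ∞)`. -/
theorem exists_inverse_of_deriv_pos {F F' : ℝ → ℝ} (hc : Continuous F) (h0 : F 0 = 0)
    (hd : ∀ x, 0 < x → HasDerivAt F (F' x) x) (hpos : ∀ x, 0 < x → 0 < F' x)
    (htop : Tendsto F atTop atTop) :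
    ∃ X : ℝ → ℝ, Continuous X ∧ StrictMono X ∧ X 0 = 0 ∧ Tendsto X atTop atTop ∧
      (∀ x, 0 ≤ x → X (F x) = x) ∧ (∀ y, 0 ≤ y → F (X y) = y) ∧
      (∀ y, 0 < y → HasDerivAt X (F' (X y))⁻¹ y) := by
  have hmonoF : StrictMonoOn F (Ici 0) := by
    refine strictMonoOn_of_deriv_pos (convex_Ici 0) hc.continuousOn fun x hx => ?_
    rw [interior_Ici] at hx
    rw [(hd x hx).deriv]
    exact hpos x hx
  -- Continuing `F` by the identity on the negative axis gives an increasing bijection of `ℝ`, whose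
  -- inverse is automatically continuous.
  let H : ℝ → ℝ := fun x => F (max x 0) + min x 0
  have hHc : Continuous H := by fun_prop
  have hHpos : ∀ x, 0 ≤ x → H x = F x := fun x hx => by simp [H, hx]
  have hHneg : ∀ x, x ≤ 0 → H x = x := fun x hx => by simp [H, hx, h0]
  have hHmono : StrictMono H := by
    intro x y hxy
    rcases le_or_gt 0 x with hx | hx
    · rw [hHpos x hx, hHpos y (hx.trans hxy.le)]
      exact hmonoF hx (hx.trans hxy.le) hxy
    · rcases le_or_gt y 0 with hy | hy
      · rwa [hHneg x hx.le, hHneg y hy]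
      · rw [hHneg x hx.le, hHpos y hy.le]
        have := hmonoF (mem_Ici.2 le_rfl) (mem_Ici.2 hy.le) hy
        linarith
  have hHtop : Tendsto H atTop atTop :=
    htop.congr' ((eventually_ge_atTop 0).mono fun x hx => (hHpos x hx).symm)
  have hHbot : Tendsto H atBot atBot :=
    tendsto_id.congr' ((eventually_le_atBot 0).mono fun x hx => (hHneg x hx).symm)
  let e := hHmono.orderIsoOfSurjective H (hHc.surjective hHtop hHbot)
  have he : ∀ x, e x = H x := fun x => rfl
  have hHX : ∀ y, H (e.symm y) = y := fun y => by rw [← he, e.apply_symm_apply]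
  have hX0 : e.symm 0 = 0 := by
    rw [e.symm_apply_eq, he, hHneg 0 le_rfl]
  have hXnn : ∀ y, 0 ≤ y → 0 ≤ e.symm y := fun y hy => by
    rw [← hX0]; exact e.symm.monotone hy
  have hXpos : ∀ y, 0 < y → 0 < e.symm y := fun y hy => by
    rw [← hX0]; exact e.symm.strictMono hy
  have hXc : Continuous e.symm := e.symm.continuous
  refine ⟨e.symm, hXc, e.symm.strictMono, hX0, e.symm.tendsto_atTop, ?_, ?_, ?_⟩
  · intro x hx
    rw [e.symm_apply_eq, he, hHpos x hx]
  · intro y hy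
    rw [← hHpos _ (hXnn y hy), hHX]
  · intro y hy
    refine HasDerivAt.of_local_left_inverse hXc.continuousAt
      (hd _ (hXpos y hy)) (hpos _ (hXpos y hy)).ne' ?_
    filter_upwards [eventually_gt_nhds hy] with z hz
    rw [← hHpos _ (hXnn z hz.le), hHX]

/-- A function whose derivative is eventually at least `1` tends to infinity. -/
theorem tendsto_atTop_of_one_le_deriv {F F' : ℝ → ℝ} {a : ℝ} (hd : ∀ x, HasDerivAt F (F' x) x)
    (h : ∀ x, a ≤ x → 1 ≤ F' x) : Tendsto F atTop atTop := by
  have hmono : MonotoneOn (fun x => F x - x) (Ici a) := by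
    have hd' : ∀ x, HasDerivAt (fun x => F x - x) (F' x - 1) x :=
      fun x => (hd x).sub (hasDerivAt_id x)
    refine monotoneOn_of_deriv_nonneg (convex_Ici a)
      (fun x _ => (hd' x).continuousAt.continuousWithinAt)
      (fun x _ => (hd' x).differentiableAt.differentiableWithinAt) fun x hx => ?_
    rw [interior_Ici] at hx
    rw [(hd' x).deriv]
    linarith [h x hx.le]
  refine tendsto_atTop_mono' atTop (f₁ := fun x => x + (F a - a)) ?_
    (tendsto_atTop_add_const_right _ _ tendsto_id)
  filter_upwards [eventually_ge_atTop a] with x hx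
  have := hmono (mem_Ici.2 le_rfl) (mem_Ici.2 hx) hx
  simp only at this
  linarith

theorem contDiffOn_one_of_hasDerivAt {f f' : ℝ → ℝ} {s : Set ℝ} (hs : IsOpen s)
    (hd : ∀ x ∈ s, HasDerivAt f (f' x) x) (hc : ContinuousOn f' s) : ContDiffOn ℝ 1 f s := by
  rw [show (1 : WithTop ℕ∞) = 0 + 1 by simp, contDiffOn_succ_iff_deriv_of_isOpen hs]
  refine ⟨fun x hx => (hd x hx).differentiableAt.differentiableWithinAt, by simp, ?_⟩
  rw [contDiffOn_zero]
  exact hc.congr fun x hx => (hd x hx).deriv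

theorem hasDerivAt_max_zero_sq (x : ℝ) :
    HasDerivAt (fun y : ℝ => (max y 0) ^ 2) (2 * max x 0) x := by
  rcases lt_trichotomy x 0 with hx | rfl | hx
  · rw [max_eq_right hx.le, mul_zero]
    refine (hasDerivAt_const x (0 : ℝ)).congr_of_eventuallyEq ?_
    filter_upwards [eventually_lt_nhds hx] with y hy
    simp [max_eq_right hy.le]
  · rw [max_self, mul_zero, hasDerivAt_iff_isLittleO]
    have : (fun y : ℝ => y ^ 2) =o[𝓝 0] fun y => y := by
      simpa using isLittleO_pow_pow (𝕜 := ℝ) (show 1 < 2 by norm_num)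
    simp only [max_self, ne_eq, OfNat.ofNat_ne_zero, not_false_eq_true, zero_pow, sub_zero,
      smul_zero]
    refine IsBigO.trans_isLittleO (IsBigO.of_bound 1 (Eventually.of_forall fun y => ?_)) this
    rw [one_mul, norm_pow, norm_pow]
    gcongr
    rcases le_total y 0 with h | h <;> simp [h]
  · rw [max_eq_left hx.le]
    have := (hasDerivAt_id x).pow 2
    simp only [id, Nat.cast_ofNat, Nat.add_one_sub_one, pow_one, mul_one] at this
    refine this.congr_of_eventuallyEq ?_
    filter_upwards [eventually_gt_nhds hx] with y hy
    simp [max_eq_left hy.le]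

/-! ### The density profile -/

/-- The density of the model star as a function of the inverse radius `x = 1 / r`: it is constant
in the core `x ≥ 1` and behaves like `x ^ n` in the outer region. -/
noncomputable def density (n x : ℝ) : ℝ :=
  (max 0 (min x 1)) ^ n * Real.exp (n * ((max 0 (min x 1) - 1) * (max 0 (min x 1) - 3) / 2))

theorem density_of_nonpos {n x : ℝ} (hn : 3 < n) (hx : x ≤ 0) : density n x = 0 := by
  have : max 0 (min x 1) = 0 := max_eq_left (min_le_of_left_le hx)
  rw [density, this, Real.zero_rpow (by linarith), zero_mul]

theorem density_of_one_le {n x : ℝ} (hx : 1 ≤ x) : density n x = 1 := by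
  have : max 0 (min x 1) = 1 := by rw [min_eq_right hx]; norm_num
  simp [density, this]

theorem density_of_mem {n x : ℝ} (hx : 0 ≤ x) (hx1 : x ≤ 1) :
    density n x = x ^ n * Real.exp (n * ((x - 1) * (x - 3) / 2)) := by
  rw [density, min_eq_left hx1, max_eq_right hx]

theorem continuous_density {n : ℝ} (hn : 3 < n) : Continuous (density n) := by
  unfold density
  exact (Continuous.rpow_const (by fun_prop) fun x => Or.inr (by linarith)).mul (by fun_prop)

theorem density_pos {n x : ℝ} (hx : 0 < x) : 0 < density n x := by
  have : 0 < max 0 (min x 1) := lt_max_of_lt_right (lt_min hx one_pos)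
  unfold density
  positivity

theorem density_nonneg (n x : ℝ) : 0 ≤ density n x := by
  have : 0 ≤ max 0 (min x 1) := le_max_left _ _
  unfold density
  positivity

/-- The exponential factor is chosen so that the logarithmic derivative is `n/x + n(x - 2) = n(1 -
x)²/x`. It is nonnegative and has a double zero at `x = 1`, so its continuation by zero is still
`C¹`. -/
theorem hasDerivAt_density {n x : ℝ} (hx : 0 < x) :
    HasDerivAt (density n) (density n x * (n * max (1 - x) 0 ^ 2 / x)) x := by
  have key : ∀ x : ℝ, 0 < x →
      HasDerivAt (fun y : ℝ => y ^ n * Real.exp (n * ((y - 1) * (y - 3) / 2)))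
        (x ^ n * Real.exp (n * ((x - 1) * (x - 3) / 2)) * (n * (1 - x) ^ 2 / x)) x := by
    intro x hx
    have h1 := Real.hasDerivAt_rpow_const (x := x) (p := n) (Or.inl hx.ne')
    have h2 := ((((hasDerivAt_id x).sub_const 1).mul ((hasDerivAt_id x).sub_const 3)).div_const
      2).const_mul n |>.exp
    refine (h1.mul h2).congr_deriv ?_
    rw [Real.rpow_sub_one hx.ne']
    simp only [id, Pi.mul_apply]
    field_simp
    ring
  rcases lt_trichotomy x 1 with h | rfl | h
  · rw [density_of_mem hx.le h.le, max_eq_left (by linarith)]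
    refine (key x hx).congr_of_eventuallyEq ?_
    filter_upwards [eventually_lt_nhds h, eventually_gt_nhds hx] with y hy hy0
    exact density_of_mem hy0.le hy.le
  · have hl : HasDerivWithinAt (density n) 0 (Iic 1) 1 := by
      have := (key 1 one_pos).hasDerivWithinAt (s := Iic 1)
      simp only [sub_self, ne_eq, OfNat.ofNat_ne_zero, not_false_eq_true, zero_pow, mul_zero,
        zero_div] at this
      refine this.congr_of_eventuallyEq ?_ (density_of_mem zero_le_one le_rfl)
      filter_upwards [self_mem_nhdsWithin,
        mem_nhdsWithin_of_mem_nhds (eventually_gt_nhds one_pos)] with y hy hy0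
      exact density_of_mem (le_of_lt hy0) hy
    have hr : HasDerivWithinAt (density n) 0 (Ici 1) 1 :=
      (hasDerivWithinAt_const (1 : ℝ) (Ici 1) (1 : ℝ)).congr
        (fun y hy => density_of_one_le hy) (density_of_one_le le_rfl)
    have := hl.union hr
    rw [Iic_union_Ici, hasDerivWithinAt_univ] at this
    simpa using this
  · rw [max_eq_right (by linarith)]
    simp only [ne_eq, OfNat.ofNat_ne_zero, not_false_eq_true, zero_pow, mul_zero, zero_div]
    refine (hasDerivAt_const x (1 : ℝ)).congr_of_eventuallyEq ?_
    filter_upwards [eventually_gt_nhds h] with y hy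
    exact density_of_one_le hy.le

/-! ### The enclosed mass -/

/-- The rate at which the mass enclosed in the radius `1 / s` decreases with `s`. -/
noncomputable def massRate (n s : ℝ) : ℝ := 4 * Real.pi * density n s / s ^ 4

theorem massRate_nonneg (n s : ℝ) : 0 ≤ massRate n s := by
  have := density_nonneg n s
  have := Real.pi_pos
  unfold massRate
  positivity

/-- The exponent exceeds `-1` because `n > 3`, which makes the total mass finite. Capping `n - 3` at
`1` lets the same power later absorb errors linear in `x`. -/
theorem massRate_le {n s : ℝ} (hn : 3 < n) (hs : 0 < s) :
    massRate n s ≤ 4 * Real.pi * Real.exp (2 * n) * s ^ (min (n - 3) 1 - 1) := by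
  have hb0 : 0 < min (n - 3) 1 := lt_min (by linarith) one_pos
  have hkey : density n s ≤ Real.exp (2 * n) * s ^ (min (n - 3) 1 + 3) := by
    rcases le_total s 1 with h | h
    · rw [density_of_mem hs.le h, mul_comm]
      refine mul_le_mul (Real.exp_le_exp.2 ?_)
        (Real.rpow_le_rpow_of_exponent_ge hs h (by linarith [min_le_left (n - 3) 1]))
        (by positivity) (by positivity)
      -- On `[0, 1]` the exponent `(s - 1)(s - 3)/2` is at most `3/2`.
      rw [mul_comm 2 n]
      exact mul_le_mul_of_nonneg_left (by nlinarith) (by linarith)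
    · rw [density_of_one_le h]
      exact one_le_mul_of_one_le_of_one_le (Real.one_le_exp (by linarith))
        (Real.one_le_rpow h (by linarith))
  have hsplit : s ^ (min (n - 3) 1 + 3) = s ^ (min (n - 3) 1 - 1) * s ^ 4 := by
    rw [← Real.rpow_add_natCast hs.ne']
    congr 1
    push_cast
    ring
  have hpi := Real.pi_pos
  rw [massRate, div_le_iff₀ (by positivity)]
  calc 4 * Real.pi * density n s
      ≤ 4 * Real.pi * (Real.exp (2 * n) * s ^ (min (n - 3) 1 + 3)) := by gcongr
    _ = _ := by rw [hsplit]; ring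

theorem intervalIntegrable_massRate {n : ℝ} (hn : 3 < n) (a b : ℝ) :
    IntervalIntegrable (massRate n) volume a b := by
  have hb0 : 0 < min (n - 3) 1 := lt_min (by linarith) one_pos
  have hg : IntervalIntegrable
      (fun s : ℝ => 4 * Real.pi * Real.exp (2 * n) * s ^ (min (n - 3) 1 - 1)) volume a b :=
    (intervalIntegral.intervalIntegrable_rpow' (by linarith)).const_mul _
  have hm : Measurable (massRate n) := by
    have := (continuous_density hn).measurable
    unfold massRate
    fun_prop
  refine hg.mono_fun hm.aestronglyMeasurable (Eventually.of_forall fun s => ?_)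
  rcases le_or_gt s 0 with h | h
  · simp only [massRate, density_of_nonpos hn h, mul_zero, zero_div, norm_zero]
    exact norm_nonneg _
  · beta_reduce
    rw [Real.norm_of_nonneg (massRate_nonneg n s)]
    exact (massRate_le hn h).trans (Real.le_norm_self _)

/-- The mass enclosed in the radius `1 / x`. -/
noncomputable def mass (n x : ℝ) : ℝ := 4 * Real.pi / 3 + ∫ s in x..1, massRate n s

theorem continuous_mass {n : ℝ} (hn : 3 < n) : Continuous (mass n) := by
  have h := intervalIntegral.continuous_primitive (intervalIntegrable_massRate hn) 1
  have : mass n = fun x => 4 * Real.pi / 3 - ∫ s in (1 : ℝ)..x, massRate n s := by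
    funext x
    rw [mass, intervalIntegral.integral_symm]
    ring
  rw [this]
  fun_prop

theorem continuousAt_massRate {n x : ℝ} (hn : 3 < n) (hx : 0 < x) :
    ContinuousAt (massRate n) x := by
  have := (continuous_density hn).continuousAt (x := x)
  unfold massRate
  exact (this.const_mul _).div (by fun_prop) (by positivity)

theorem hasDerivAt_mass {n x : ℝ} (hn : 3 < n) (hx : 0 < x) :
    HasDerivAt (mass n) (-massRate n x) x := by
  have hm : Measurable (massRate n) := by
    have := (continuous_density hn).measurable
    unfold massRate
    fun_prop
  exact (intervalIntegral.integral_hasDerivAt_left (intervalIntegrable_massRate hn x 1)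
    hm.stronglyMeasurable.stronglyMeasurableAtFilter (continuousAt_massRate hn hx)).const_add _

/-- The constant `4π/3` in `mass` is the mass of the unit ball at density `1`, so the core is a
homogeneous ball with no point mass at its centre. -/
theorem mass_of_one_le {n x : ℝ} (hx : 1 ≤ x) : mass n x = 4 * Real.pi / 3 / x ^ 3 := by
  have hd : ∀ s ∈ uIcc x 1, HasDerivAt (fun s : ℝ => -(4 * Real.pi / 3 / s ^ 3))
      (massRate n s) s := by
    intro s hs
    rw [uIcc_of_ge hx] at hs
    have hs0 : 0 < s := one_pos.trans_le hs.1
    rw [massRate, density_of_one_le hs.1]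
    refine ((hasDerivAt_const s (4 * Real.pi / 3)).div (hasDerivAt_pow 3 s)
      (by positivity)).neg.congr_deriv ?_
    field_simp
    ring
  have hint : IntervalIntegrable (massRate n) volume x 1 := by
    refine ContinuousOn.intervalIntegrable ?_
    have : ContinuousOn (fun s : ℝ => 4 * Real.pi * 1 / s ^ 4) (uIcc x 1) := by
      refine continuousOn_const.div (by fun_prop) fun s hs => ?_
      rw [uIcc_of_ge hx] at hs
      have hs0 : 0 < s := one_pos.trans_le hs.1
      positivity
    refine this.congr fun s hs => ?_
    rw [uIcc_of_ge hx] at hs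
    rw [massRate, density_of_one_le hs.1]
  rw [mass, intervalIntegral.integral_eq_sub_of_hasDerivAt hd hint]
  ring

theorem mass_le_mass {n x y : ℝ} (hn : 3 < n) (hxy : x ≤ y) : mass n y ≤ mass n x := by
  have h1 := intervalIntegral.integral_add_adjacent_intervals
    (intervalIntegrable_massRate hn x y) (intervalIntegrable_massRate hn y 1)
  have h2 : 0 ≤ ∫ s in x..y, massRate n s :=
    intervalIntegral.integral_nonneg hxy fun s _ => massRate_nonneg n s
  unfold mass
  linarith

theorem mass_pos {n : ℝ} (hn : 3 < n) (x : ℝ) : 0 < mass n x := by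
  have hpi := Real.pi_pos
  rcases le_total x 1 with h | h
  · refine lt_of_lt_of_le ?_ (mass_le_mass hn h)
    rw [mass_of_one_le le_rfl]
    positivity
  · rw [mass_of_one_le h]
    positivity

theorem mass_zero_sub_le {n x : ℝ} (hn : 3 < n) (hx : 0 < x) :
    mass n 0 - mass n x ≤
      4 * Real.pi * Real.exp (2 * n) / min (n - 3) 1 * x ^ min (n - 3) 1 := by
  have hb0 : 0 < min (n - 3) 1 := lt_min (by linarith) one_pos
  have h1 := intervalIntegral.integral_add_adjacent_intervals
    (intervalIntegrable_massRate hn 0 x) (intervalIntegrable_massRate hn x 1)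
  have h2 : ∫ s in (0 : ℝ)..x, massRate n s ≤
      ∫ s in (0 : ℝ)..x, 4 * Real.pi * Real.exp (2 * n) * s ^ (min (n - 3) 1 - 1) := by
    refine intervalIntegral.integral_mono_on_of_le_Ioo hx.le (intervalIntegrable_massRate hn 0 x)
      ((intervalIntegral.intervalIntegrable_rpow' (by linarith)).const_mul _) fun s hs => ?_
    exact massRate_le hn hs.1
  rw [intervalIntegral.integral_const_mul, integral_rpow (Or.inl (by linarith)),
    sub_add_cancel, Real.zero_rpow hb0.ne', sub_zero] at h2
  have h3 : mass n 0 - mass n x = ∫ s in (0 : ℝ)..x, massRate n s := by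
    unfold mass
    linarith
  rw [h3]
  exact h2.trans_eq (by ring)

/-! ### The stretched parametrisation of `η` and `p` -/

/-- A modification of `mass` in the core that keeps its primitives unbounded. -/
noncomputable def stretchedMass (n x : ℝ) : ℝ := mass n x + max (x - 1) 0 ^ 2

theorem stretchedMass_of_le_one {n x : ℝ} (hx : x ≤ 1) : stretchedMass n x = mass n x := by
  simp [stretchedMass, hx]

theorem continuous_stretchedMass {n : ℝ} (hn : 3 < n) : Continuous (stretchedMass n) := by
  have := continuous_mass hn
  unfold stretchedMass
  fun_prop

theorem stretchedMass_pos {n : ℝ} (hn : 3 < n) (x : ℝ) : 0 < stretchedMass n x :=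
  add_pos_of_pos_of_nonneg (mass_pos hn x) (sq_nonneg _)

theorem one_le_stretchedMass {n x : ℝ} (hn : 3 < n) (hx : 2 ≤ x) : 1 ≤ stretchedMass n x := by
  have := mass_pos hn x
  rw [stretchedMass, max_eq_left (by linarith)]
  nlinarith

theorem hasDerivAt_max_sub_one_sq (x : ℝ) :
    HasDerivAt (fun y : ℝ => max (y - 1) 0 ^ 2) (2 * max (x - 1) 0) x :=
  (hasDerivAt_max_zero_sq (x - 1)).comp_sub_const x 1

theorem hasDerivAt_max_one_sub_sq (x : ℝ) :
    HasDerivAt (fun y : ℝ => max (1 - y) 0 ^ 2) (-(2 * max (1 - x) 0)) x :=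
  (hasDerivAt_max_zero_sq (1 - x)).comp_const_sub 1 x

/-- The added term is a square so that the junction at `x = 1` stays `C¹`, as the index-function
requires. -/
theorem contDiffOn_stretchedMass {n : ℝ} (hn : 3 < n) :
    ContDiffOn ℝ 1 (stretchedMass n) (Ioi 0) := by
  refine contDiffOn_one_of_hasDerivAt isOpen_Ioi
    (fun x hx => (hasDerivAt_mass hn hx).add (hasDerivAt_max_sub_one_sq x)) ?_
  refine ContinuousOn.add (fun x hx => ?_) (by fun_prop)
  exact (continuousAt_massRate hn hx).neg.continuousWithinAt

/-- The primitive of `stretchedMass`: the quantity `η` as a function of the parameter `x`. -/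
noncomputable def potential (n x : ℝ) : ℝ := ∫ s in (0 : ℝ)..x, stretchedMass n s

theorem hasDerivAt_potential {n : ℝ} (hn : 3 < n) (x : ℝ) :
    HasDerivAt (potential n) (stretchedMass n x) x :=
  ((continuous_stretchedMass hn).integral_hasStrictDerivAt 0 x).hasDerivAt

theorem continuous_potential {n : ℝ} (hn : 3 < n) : Continuous (potential n) :=
  continuous_iff_continuousAt.2 fun x => (hasDerivAt_potential hn x).continuousAt

theorem potential_zero (n : ℝ) : potential n 0 = 0 := intervalIntegral.integral_same

theorem contDiffOn_potential {n : ℝ} (hn : 3 < n) : ContDiffOn ℝ 1 (potential n) (Ioi 0) :=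
  contDiffOn_one_of_hasDerivAt isOpen_Ioi (fun x _ => hasDerivAt_potential hn x)
    (continuous_stretchedMass hn).continuousOn

theorem tendsto_potential {n : ℝ} (hn : 3 < n) : Tendsto (potential n) atTop atTop :=
  tendsto_atTop_of_one_le_deriv (hasDerivAt_potential hn) fun _ => one_le_stretchedMass hn

theorem potential_nonneg {n x : ℝ} (hn : 3 < n) (hx : 0 ≤ x) : 0 ≤ potential n x :=
  intervalIntegral.integral_nonneg hx fun s _ => (stretchedMass_pos hn s).le

theorem mul_mass_le_potential {n x : ℝ} (hn : 3 < n) (hx : 0 ≤ x) (hx1 : x ≤ 1) :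
    x * mass n x ≤ potential n x := by
  have : ∫ _ in (0 : ℝ)..x, mass n x ≤ potential n x := by
    refine intervalIntegral.integral_mono_on hx (by simp)
      ((continuous_stretchedMass hn).intervalIntegrable _ _) fun s hs => ?_
    rw [stretchedMass_of_le_one (hs.2.trans hx1)]
    exact mass_le_mass hn hs.2
  simpa using this

theorem potential_le_mul_mass_zero {n x : ℝ} (hn : 3 < n) (hx : 0 ≤ x) (hx1 : x ≤ 1) :
    potential n x ≤ x * mass n 0 := by
  have : potential n x ≤ ∫ _ in (0 : ℝ)..x, mass n 0 := by
    refine intervalIntegral.integral_mono_on hx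
      ((continuous_stretchedMass hn).intervalIntegrable _ _) (by simp) fun s hs => ?_
    rw [stretchedMass_of_le_one (hs.2.trans hx1)]
    exact mass_le_mass hn hs.1
  simpa using this

/-- The pressure of the equation of state as a function of the parameter `x`. -/
noncomputable def stretchedPressure (n x : ℝ) : ℝ :=
  ∫ s in (0 : ℝ)..x, stretchedMass n s * density n s

theorem hasDerivAt_stretchedPressure {n : ℝ} (hn : 3 < n) (x : ℝ) :
    HasDerivAt (stretchedPressure n) (stretchedMass n x * density n x) x :=
  (((continuous_stretchedMass hn).mul (continuous_density hn)).integral_hasStrictDerivAt 0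
    x).hasDerivAt

theorem continuous_stretchedPressure {n : ℝ} (hn : 3 < n) : Continuous (stretchedPressure n) :=
  continuous_iff_continuousAt.2 fun x => (hasDerivAt_stretchedPressure hn x).continuousAt

theorem tendsto_stretchedPressure {n : ℝ} (hn : 3 < n) :
    Tendsto (stretchedPressure n) atTop atTop := by
  refine tendsto_atTop_of_one_le_deriv (a := 2) (hasDerivAt_stretchedPressure hn) fun x hx => ?_
  rw [density_of_one_le (by linarith), mul_one]
  exact one_le_stretchedMass hn hx

/-! ### The index-function -/

/-- The index of the model equation of state as a function of the parameter `x`. -/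
noncomputable def indexParam (n x : ℝ) : ℝ :=
  n * max (1 - x) 0 ^ 2 * potential n x / (x * stretchedMass n x)

theorem indexParam_of_one_le {n x : ℝ} (hx : 1 ≤ x) : indexParam n x = 0 := by
  simp [indexParam, hx]

theorem contDiffOn_indexParam {n : ℝ} (hn : 3 < n) : ContDiffOn ℝ 1 (indexParam n) (Ioi 0) := by
  have h1 : ContDiffOn ℝ 1 (fun x : ℝ => max (1 - x) 0 ^ 2) (Ioi 0) :=
    contDiffOn_one_of_hasDerivAt isOpen_Ioi (fun x _ => hasDerivAt_max_one_sub_sq x)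
      (by fun_prop)
  unfold indexParam
  refine ((contDiffOn_const.mul h1).mul (contDiffOn_potential hn)).div
    (contDiffOn_id.mul (contDiffOn_stretchedMass hn)) fun x hx => ?_
  exact (mul_pos hx (stretchedMass_pos hn x)).ne'

theorem indexParam_nonneg {n x : ℝ} (hn : 3 < n) (hx : 0 < x) : 0 ≤ indexParam n x := by
  have := stretchedMass_pos hn x
  have := potential_nonneg hn hx.le
  unfold indexParam
  positivity

theorem indexParam_le {n x : ℝ} (hn : 3 < n) (hx : 0 < x) :
    indexParam n x ≤ n * mass n 0 / mass n 1 := by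
  have hn0 : 0 < n := by linarith
  have hm0 := mass_pos hn 0
  have hm1 := mass_pos hn 1
  rcases le_total x 1 with h | h
  · have hmx := mass_pos hn x
    have hle := mass_le_mass hn h
    have hG := potential_le_mul_mass_zero hn hx.le h
    have hG0 := potential_nonneg hn hx.le
    have hsq : (1 - x) ^ 2 ≤ 1 := by nlinarith
    rw [indexParam, stretchedMass_of_le_one h, max_eq_left (by linarith)]
    calc n * (1 - x) ^ 2 * potential n x / (x * mass n x)
        ≤ n * 1 * (x * mass n 0) / (x * mass n 1) := by gcongr
      _ = n * mass n 0 / mass n 1 := by field_simp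
  · rw [indexParam_of_one_le h]
    positivity

/-- The index approaches `n` like a power of the parameter. -/
theorem exists_abs_indexParam_sub_le {n : ℝ} (hn : 3 < n) :
    ∃ C, 0 ≤ C ∧ ∀ x, 0 < x → x ≤ 1 → |indexParam n x - n| ≤ C * x ^ min (n - 3) 1 := by
  have hn0 : 0 < n := by linarith
  have hb0 : 0 < min (n - 3) 1 := lt_min (by linarith) one_pos
  have hm1 := mass_pos hn 1
  have hpi := Real.pi_pos
  set b := min (n - 3) 1 with hb
  set D := 4 * Real.pi * Real.exp (2 * n) / b with hD
  have hD0 : 0 < D := by positivity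
  refine ⟨n * (D / mass n 1 + 2), by positivity, fun x hx h => ?_⟩
  have hmx := mass_pos hn x
  have hxb : x ≤ x ^ b := by
    simpa using Real.rpow_le_rpow_of_exponent_ge hx h (min_le_right (n - 3) 1)
  have hM := mass_zero_sub_le hn hx
  rw [← hb, ← hD] at hM
  -- `q` compares the average of the mass over `[0, x]` with its value at `x`; it is at least `1`
  -- because the mass decreases in `x`.
  set q := potential n x / (x * mass n x) with hq
  have hq1 : 1 ≤ q := (one_le_div (by positivity)).2 (mul_mass_le_potential hn hx.le h)
  have hq2 : q - 1 ≤ D / mass n 1 * x ^ b := by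
    calc q - 1 ≤ x * mass n 0 / (x * mass n x) - 1 := by
          rw [hq]
          gcongr
          exact potential_le_mul_mass_zero hn hx.le h
      _ = (mass n 0 - mass n x) / mass n x := by field_simp
      _ ≤ (D * x ^ b) / mass n 1 := div_le_div₀ (by positivity) hM hm1 (mass_le_mass hn h)
      _ = _ := by ring
  have hform : indexParam n x - n = n * ((1 - x) ^ 2 * q - 1) := by
    rw [indexParam, stretchedMass_of_le_one h, max_eq_left (by linarith), hq]
    ring
  have hs0 : (1 - x) ^ 2 ≤ 1 := by nlinarith
  have hs1 : 1 - 2 * x ≤ (1 - x) ^ 2 := by nlinarith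
  have hdx : 0 ≤ D / mass n 1 * x ^ b := by positivity
  rw [hform, abs_mul, abs_of_pos hn0, mul_assoc]
  refine mul_le_mul_of_nonneg_left (abs_le.2 ⟨?_, ?_⟩) hn0.le
  -- Lower bound: `(1 - x)² q ≥ (1 - x)² ≥ 1 - 2x`, and `x ≤ x ^ b`. The upper bound uses `(1 - x)²
  -- q ≤ q`.
  · nlinarith [mul_nonneg (sq_nonneg (1 - x)) (sub_nonneg.2 hq1)]
  · nlinarith [mul_nonneg (sub_nonneg.2 hs0) (zero_le_one.trans hq1)]

/-! ### The equation of state -/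

/-- `eta` is the potential, expressed through the inverse `Y` of the pressure. -/
theorem eta_eq_potential {n : ℝ} (hn : 3 < n) {Y : ℝ → ℝ} (hYc : Continuous Y)
    (hY0 : Y 0 = 0)
    (hYd : ∀ p, 0 < p → HasDerivAt Y (stretchedMass n (Y p) * density n (Y p))⁻¹ p)
    {p : ℝ} (hp : 0 < p) :
    IntervalIntegrable (fun s => (density n (Y s))⁻¹) volume 0 p ∧
      eta (fun p => density n (Y p)) p = potential n (Y p) := by
  have hc : Continuous fun s => potential n (Y s) := (continuous_potential hn).comp hYc
  have hd : ∀ s, 0 < s → HasDerivAt (fun s => potential n (Y s)) (density n (Y s))⁻¹ s := by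
    intro s hs
    refine ((hasDerivAt_potential hn (Y s)).comp s (hYd s hs)).congr_deriv ?_
    have := (stretchedMass_pos hn (Y s)).ne'
    field_simp
  -- The integrand is singular at `p = 0`, but a nonnegative derivative of a function continuous up
  -- to the endpoint is integrable.
  have hi : IntervalIntegrable (fun s => (density n (Y s))⁻¹) volume 0 p := by
    refine intervalIntegral.intervalIntegrable_deriv_of_nonneg hc.continuousOn
      (fun s hs => hd s ?_) fun s _ => inv_nonneg.2 (density_nonneg n _)
    rw [min_eq_left hp.le] at hs
    exact hs.1
  refine ⟨hi, ?_⟩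
  rw [eta, intervalIntegral.integral_eq_sub_of_hasDerivAt_of_le hp.le hc.continuousOn
    (fun s hs => hd s hs.1) hi, hY0, potential_zero, sub_zero]

theorem exists_isAsymptoticallyPolytropic {n : ℝ} (hn : 3 < n) :
    ∃ Y : ℝ → ℝ, Monotone Y ∧ (∀ x, 0 ≤ x → Y (stretchedPressure n x) = x) ∧
      IsAsymptoticallyPolytropic (fun p => density n (Y p)) n 0 := by
  obtain ⟨X, hXc, hXm, hX0, hXtop, hXG, hGX, hXd⟩ :=
    exists_inverse_of_deriv_pos (continuous_potential hn) (potential_zero n)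
      (fun x _ => hasDerivAt_potential hn x) (fun x _ => stretchedMass_pos hn x)
      (tendsto_potential hn)
  obtain ⟨Y, hYc, hYm, hY0, hYtop, hYP, -, hYd⟩ :=
    exists_inverse_of_deriv_pos (continuous_stretchedPressure hn)
      intervalIntegral.integral_same (fun x _ => hasDerivAt_stretchedPressure hn x)
      (fun x hx => mul_pos (stretchedMass_pos hn x) (density_pos hx))
      (tendsto_stretchedPressure hn)
  have hXpos : ∀ y, 0 < y → 0 < X y := fun y hy => hX0 ▸ hXm hy
  have hYpos : ∀ y, 0 < y → 0 < Y y := fun y hy => hY0 ▸ hYm hy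
  have heta := fun p (hp : 0 < p) => eta_eq_potential hn hYc hY0 hYd hp
  have hXcd : ContDiffOn ℝ 1 X (Ioi 0) := by
    refine contDiffOn_one_of_hasDerivAt isOpen_Ioi hXd (Continuous.continuousOn ?_)
    exact ((continuous_stretchedMass hn).comp hXc).inv₀ fun y => (stretchedMass_pos hn _).ne'
  refine ⟨Y, hYm.monotone, hYP, ⟨⟨((continuous_density hn).comp hYc).continuousOn,
    fun p hp => density_pos (hYpos p hp), fun p hp => (heta p hp).1⟩, ?_,
    fun y => indexParam n (X y), ?_, ?_, ?_, ?_, ?_, ?_⟩⟩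
  · refine ((tendsto_potential hn).comp hYtop).congr' ?_
    filter_upwards [eventually_gt_atTop 0] with p hp
    exact (heta p hp).2.symm
  · intro p hp
    have hx := hYpos p hp
    have hm := stretchedMass_pos hn (Y p)
    have hr := density_pos (n := n) hx
    have hG : 0 < potential n (Y p) := by
      rw [← hXm.lt_iff_lt, hX0, hXG _ hx.le]
      exact hx
    rw [(heta p hp).2]
    beta_reduce
    rw [hXG _ hx.le]
    -- With `M` the stretched mass, `dρ/dp = (dρ/dx)/(Mρ) = n max(1 - x, 0)²/(xM)`, which is the
    -- index divided by `η`.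
    refine ((hasDerivAt_density hx).comp p (hYd p hp)).congr_deriv ?_
    rw [indexParam]
    field_simp
  · exact (contDiffOn_indexParam hn).comp hXcd hXpos
  · exact fun x hx => indexParam_nonneg hn (hXpos x hx)
  · refine ⟨n * mass n 0 / mass n 1, fun x hx => ?_⟩
    rw [abs_of_nonneg (indexParam_nonneg hn (hXpos x hx))]
    exact indexParam_le hn (hXpos x hx)
  · have hb0 : 0 < min (n - 3) 1 := lt_min (by linarith) one_pos
    have hm1 := mass_pos hn 1
    obtain ⟨C, hC0, hC⟩ := exists_abs_indexParam_sub_le hn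
    refine ⟨min (n - 3) 1, hb0, IsBigO.of_bound (C * (mass n 1)⁻¹ ^ min (n - 3) 1) ?_⟩
    have hX1 : ∀ᶠ y in 𝓝[>] (0 : ℝ), X y < 1 := by
      refine (hXc.tendsto 0).mono_left nhdsWithin_le_nhds |>.eventually_lt_const ?_
      rw [hX0]
      exact one_pos
    filter_upwards [self_mem_nhdsWithin, hX1] with y hy hy1
    have hy : 0 < y := hy
    have hx := hXpos y hy
    have hle : X y ≤ (mass n 1)⁻¹ * y := by
      have h1 := mul_mass_le_potential hn hx.le hy1.le
      rw [hGX y hy.le] at h1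
      rw [inv_mul_eq_div, le_div_iff₀ hm1]
      exact (mul_le_mul_of_nonneg_left (mass_le_mass hn hy1.le) hx.le).trans h1
    rw [Real.norm_eq_abs, Real.norm_of_nonneg (by positivity), mul_assoc,
      ← Real.mul_rpow (by positivity) hy.le]
    refine (hC _ hx hy1.le).trans (mul_le_mul_of_nonneg_left ?_ hC0)
    exact Real.rpow_le_rpow hx.le hle hb0.le
  -- The index vanishes identically for large `η`, so any decay exponent would do.
  · refine ⟨1, one_pos, IsBigO.of_bound 0 ?_⟩
    filter_upwards [hXtop.eventually_ge_atTop 1] with y hy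
    simp [indexParam_of_one_le hy]

/-! ### The model star -/

/-- The pressure of the model star at the radius `1 / x`. -/
noncomputable def pressure (n x : ℝ) : ℝ := ∫ s in (0 : ℝ)..x, mass n s * density n s

theorem hasDerivAt_pressure {n : ℝ} (hn : 3 < n) (x : ℝ) :
    HasDerivAt (pressure n) (mass n x * density n x) x :=
  (((continuous_mass hn).mul (continuous_density hn)).integral_hasStrictDerivAt 0
    x).hasDerivAt

theorem pressure_mono {n x y : ℝ} (hn : 3 < n) (hxy : x ≤ y) : pressure n x ≤ pressure n y := by
  refine monotone_of_deriv_nonneg (fun x => (hasDerivAt_pressure hn x).differentiableAt)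
    (fun x => ?_) hxy
  rw [(hasDerivAt_pressure hn x).deriv]
  exact mul_nonneg (mass_pos hn x).le (density_nonneg n x)

theorem pressure_pos {n x : ℝ} (hn : 3 < n) (hx : 0 < x) : 0 < pressure n x :=
  intervalIntegral.intervalIntegral_pos_of_pos_on
    (((continuous_mass hn).mul (continuous_density hn)).intervalIntegrable _ _)
    (fun s hs => mul_pos (mass_pos hn s) (density_pos hs.1)) hx

theorem pressure_eq_stretchedPressure {n x : ℝ} (hx : 0 ≤ x) (hx1 : x ≤ 1) :
    pressure n x = stretchedPressure n x := by
  refine intervalIntegral.integral_congr fun s hs => ?_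
  rw [uIcc_of_le hx] at hs
  simp only [stretchedMass_of_le_one (hs.2.trans hx1)]

/-- Letting `x → ∞` shows that the central pressure is finite and equals `pressure n 1 + 2π/3`. -/
theorem pressure_of_one_le {n x : ℝ} (hn : 3 < n) (hx : 1 ≤ x) :
    pressure n x = pressure n 1 + 2 * Real.pi / 3 * (1 - 1 / x ^ 2) := by
  have hi := fun a b =>
    ((continuous_mass hn).mul (continuous_density hn)).intervalIntegrable (μ := volume) a b
  have hd : ∀ s ∈ uIcc 1 x, HasDerivAt (fun s : ℝ => -(2 * Real.pi / 3 / s ^ 2))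
      (mass n s * density n s) s := by
    intro s hs
    rw [uIcc_of_le hx] at hs
    have hs0 : 0 < s := one_pos.trans_le hs.1
    rw [mass_of_one_le hs.1, density_of_one_le hs.1]
    refine ((hasDerivAt_const s (2 * Real.pi / 3)).div (hasDerivAt_pow 2 s)
      (by positivity)).neg.congr_deriv ?_
    field_simp
    ring
  have h1 := intervalIntegral.integral_add_adjacent_intervals (hi 0 1) (hi 1 x)
  have h2 := intervalIntegral.integral_eq_sub_of_hasDerivAt hd (hi 1 x)
  simp only [pressure, Pi.mul_apply] at h1 h2 ⊢
  rw [← h1, h2]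
  ring

/-- For `x ≤ 1` the two pressures agree. For `x ≥ 1` they may differ, but both `x` and `Y (pressure
n x)` are then at least `1`, where the density is constant. -/
theorem density_inverse_pressure {n x : ℝ} (hn : 3 < n) {Y : ℝ → ℝ} (hY : Monotone Y)
    (hYP : ∀ x, 0 ≤ x → Y (stretchedPressure n x) = x) (hx : 0 ≤ x) :
    density n (Y (pressure n x)) = density n x := by
  rcases le_total x 1 with h | h
  · rw [pressure_eq_stretchedPressure hx h, hYP x hx]
  · have h1 : Y (pressure n 1) = 1 := by
      rw [pressure_eq_stretchedPressure zero_le_one le_rfl, hYP 1 zero_le_one]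
    rw [density_of_one_le h, density_of_one_le (h1 ▸ hY (pressure_mono hn h))]

theorem isRegularSolution_mass_pressure {n : ℝ} (hn : 3 < n) {Y : ℝ → ℝ} (hY : Monotone Y)
    (hYP : ∀ x, 0 ≤ x → Y (stretchedPressure n x) = x) :
    IsRegularSolution (fun p => density n (Y p)) (pressure n 1 + 2 * Real.pi / 3) ⊤
      (fun r => mass n r⁻¹) (fun r => pressure n r⁻¹) where
  radius_pos := EReal.zero_lt_top
  pc_pos := by
    have := pressure_pos hn one_pos
    positivity
  mass_center := by
    have h : Tendsto (fun r : ℝ => 4 * Real.pi / 3 * r ^ 3) (𝓝[>] 0) (𝓝 0) := by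
      have : Continuous fun r : ℝ => 4 * Real.pi / 3 * r ^ 3 := by fun_prop
      simpa using (this.tendsto 0).mono_left nhdsWithin_le_nhds
    refine h.congr' ?_
    filter_upwards [Ioc_mem_nhdsGT one_pos] with r hr
    rw [mass_of_one_le ((one_le_inv₀ hr.1).2 hr.2)]
    simp
  pressure_center := by
    have h : Tendsto (fun r : ℝ => pressure n 1 + 2 * Real.pi / 3 * (1 - r ^ 2)) (𝓝[>] 0)
        (𝓝 (pressure n 1 + 2 * Real.pi / 3)) := by
      have : Continuous fun r : ℝ => pressure n 1 + 2 * Real.pi / 3 * (1 - r ^ 2) := by fun_prop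
      simpa using (this.tendsto 0).mono_left nhdsWithin_le_nhds
    refine h.congr' ?_
    filter_upwards [Ioc_mem_nhdsGT one_pos] with r hr
    rw [pressure_of_one_le hn ((one_le_inv₀ hr.1).2 hr.2)]
    simp
  pressure_pos := fun r hr _ => pressure_pos hn (inv_pos.2 hr)
  mass_eq := by
    intro r hr _
    rw [density_inverse_pressure hn hY hYP (inv_pos.2 hr).le]
    refine ((hasDerivAt_mass hn (inv_pos.2 hr)).comp r (hasDerivAt_inv hr.ne')).congr_deriv ?_
    rw [massRate]
    field_simp
  pressure_eq := by
    intro r hr _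
    rw [density_inverse_pressure hn hY hYP (inv_pos.2 hr).le]
    refine ((hasDerivAt_pressure hn r⁻¹).comp r (hasDerivAt_inv hr.ne')).congr_deriv ?_
    field_simp
  surface := fun h => absurd rfl h

theorem theorem4 (n₀ : ℝ) (hn₀ : 3 < n₀) :
    ∃ (ρ : ℝ → ℝ) (n₁ : ℝ), IsAsymptoticallyPolytropic ρ n₀ n₁ ∧
      ∃ (pc : ℝ) (m p : ℝ → ℝ), IsRegularSolution ρ pc ⊤ m p := by
  obtain ⟨Y, hY, hYP, h⟩ := exists_isAsymptoticallyPolytropic hn₀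
  exact ⟨_, 0, h, _, _, _, isRegularSolution_mass_pressure hn₀ hY hYP⟩
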